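/- Let $\Bbbk$ be an algebraically closed field of characteristic zero and let $q\in\Bbbk^{\times}$ not be a root of unity. Let $U^+=U_q^+(B_2)$ be the associative unital $\Bbbk$-algebra generated by $e_1,e_2$ with the quantum Serre relations $$e_1^2e_2-(q^2+q^{-2})e_1e_2e_1+e_2e_1^2=0,$$ $$e_2^3e_1-(q^2+1+q^{-2})e_2^2e_1e_2+(q^2+1+q^{-2})e_2e_1e_2^2-e_1e_2^3=0,$$ with its canonical grading $U^+=\bigoplus_{n\ge 0}U_n$ in which $e_1$ and $e_2$ have degree one, that is, $U_n$ is the linear span of the words of length $n$ in $e_1,e_2$. Put $$e_3=e_1e_2-q^2e_2e_1,\quad z=e_2e_3-q^2e_3e_2,\quad w=e_2e_3-e_3e_2,\quad z'=e_1w-q^{-4}we_1.$$ Let $Z(U^+)$ be the center of $U^+$, and let $N(U^+)$ be the set of normal (normalizing) elements of $U^+$, i.e. of those $f\in U^+$ with $fU^+=U^+f$. Then $$N(U^+)=Z(U^+)=\Bbbk[z,z'],$$ where $\Bbbk[z,z']$ is the subalgebra generated by $z$ and $z'$, and it is a polynomial algebra in the two variables $z,z'$ (there is an isomorphism of $\Bbbk$-algebras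 from the polynomial algebra $\Bbbk[X,Y]$ onto $Z(U^+)$ that sends $X$ to $z$ and $Y$ to $z'$). Moreover $z\in U_3$ and $z'\in U_4$. -/

import Mathlib

namespace UqB2

variable {k : Type*} [Field k]

/-- The defining relations (the quantum Serre relations of type `B₂`) on the free algebra on two
generators `E₁ = ι 0` and `E₂ = ι 1`, for the Cartan matrix `(2, -1; -2, 2)` and
`(d₁, d₂) = (2, 1)`. -/
inductive SerreRel (q : k) : FreeAlgebra k (Fin 2) → FreeAlgebra k (Fin 2) → Prop
  | s1 : SerreRel q
      (FreeAlgebra.ι k 0 ^ 2 * FreeAlgebra.ι k 1 + FreeAlgebra.ι k 1 * FreeAlgebra.ι k 0 ^ 2)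
      ((q ^ 2 + (q ^ 2)⁻¹) • (FreeAlgebra.ι k 0 * FreeAlgebra.ι k 1 * FreeAlgebra.ι k 0))
  | s2 : SerreRel q
      (FreeAlgebra.ι k 1 ^ 3 * FreeAlgebra.ι k 0
        + (q ^ 2 + 1 + (q ^ 2)⁻¹) •
            (FreeAlgebra.ι k 1 * FreeAlgebra.ι k 0 * FreeAlgebra.ι k 1 ^ 2))
      ((q ^ 2 + 1 + (q ^ 2)⁻¹) •
            (FreeAlgebra.ι k 1 ^ 2 * FreeAlgebra.ι k 0 * FreeAlgebra.ι k 1)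
        + FreeAlgebra.ι k 0 * FreeAlgebra.ι k 1 ^ 3)

/-- The algebra `U⁺ = U_q⁺(B₂)`. -/
def UPlus (q : k) : Type _ := RingQuot (SerreRel q)

noncomputable instance instRing (q : k) : Ring (UPlus q) :=
  inferInstanceAs (Ring (RingQuot (SerreRel q)))

noncomputable instance instAlgebra (q : k) : Algebra k (UPlus q) :=
  inferInstanceAs (Algebra k (RingQuot (SerreRel q)))

/-- The quotient map from the free algebra. -/
noncomputable def mk (q : k) : FreeAlgebra k (Fin 2) →ₐ[k] UPlus q :=
  RingQuot.mkAlgHom k (SerreRel q)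

/-- The generator `e₁`. -/
noncomputable def e₁ (q : k) : UPlus q := mk q (FreeAlgebra.ι k 0)

/-- The generator `e₂`. -/
noncomputable def e₂ (q : k) : UPlus q := mk q (FreeAlgebra.ι k 1)

/-- `e₃ = e₁ e₂ - q² e₂ e₁`. -/
noncomputable def e₃ (q : k) : UPlus q := e₁ q * e₂ q - q ^ 2 • (e₂ q * e₁ q)

/-- `z = e₂ e₃ - q² e₃ e₂`. -/
noncomputable def z (q : k) : UPlus q := e₂ q * e₃ q - q ^ 2 • (e₃ q * e₂ q)

/-- `w = e₂ e₃ - e₃ e₂`. -/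
noncomputable def w (q : k) : UPlus q := e₂ q * e₃ q - e₃ q * e₂ q

/-- `z' = e₁ w - q⁻⁴ w e₁`. -/
noncomputable def z' (q : k) : UPlus q := e₁ q * w q - (q ^ 4)⁻¹ • (w q * e₁ q)

/-- The homogeneous component `U_n` of the canonical grading of `U⁺`, in which `e₁` and `e₂` have
degree one: the span of the words of length `n` in `e₁` and `e₂`. -/
noncomputable def component (q : k) (n : ℕ) : Submodule k (UPlus q) :=
  Submodule.span k {e₁ q, e₂ q} ^ n

/-- An element `a` of an algebra `A` is normal (normalizing) if `a A = A a`. -/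
def IsNormalElement {A : Type*} [Mul A] (a : A) : Prop :=
  Set.range (fun b : A => a * b) = Set.range (fun b : A => b * a)

theorem mk_rel {q : k} {x y : FreeAlgebra k (Fin 2)} (h : SerreRel q x y) : mk q x = mk q y :=
  RingQuot.mkAlgHom_rel k h

/-- The universal property of `U⁺`. -/
noncomputable def lift (q : k) {A : Type*} [Semiring A] [Algebra k A]
    (f : FreeAlgebra k (Fin 2) →ₐ[k] A) (hf : ∀ ⦃x y⦄, SerreRel q x y → f x = f y) :
    UPlus q →ₐ[k] A :=
  RingQuot.liftAlgHom k ⟨f, hf⟩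

theorem lift_mk (q : k) {A : Type*} [Semiring A] [Algebra k A]
    (f : FreeAlgebra k (Fin 2) →ₐ[k] A) (hf : ∀ ⦃x y⦄, SerreRel q x y → f x = f y)
    (x : FreeAlgebra k (Fin 2)) : lift q f hf (mk q x) = f x :=
  RingQuot.liftAlgHom_mkAlgHom_apply k f hf x

theorem hom_ext {q : k} {A : Type*} [Semiring A] [Algebra k A] {f g : UPlus q →ₐ[k] A}
    (h₁ : f (e₁ q) = g (e₁ q)) (h₂ : f (e₂ q) = g (e₂ q)) : f = g := by
  refine RingQuot.ringQuot_ext' k f g ?_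
  apply FreeAlgebra.hom_ext
  funext i
  fin_cases i
  · exact h₁
  · exact h₂

theorem s1_eq (q : k) : e₁ q ^ 2 * e₂ q + e₂ q * e₁ q ^ 2
    = (q ^ 2 + (q ^ 2)⁻¹) • (e₁ q * e₂ q * e₁ q) := by
  have h := mk_rel (SerreRel.s1 (q := q))
  simpa only [e₁, e₂, map_add, map_mul, map_pow, map_smul] using h

theorem s2_eq (q : k) : e₂ q ^ 3 * e₁ q
    + (q ^ 2 + 1 + (q ^ 2)⁻¹) • (e₂ q * e₁ q * e₂ q ^ 2)
    = (q ^ 2 + 1 + (q ^ 2)⁻¹) • (e₂ q ^ 2 * e₁ q * e₂ q) + e₁ q * e₂ q ^ 3 := by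
  have h := mk_rel (SerreRel.s2 (q := q))
  simpa only [e₁, e₂, map_add, map_mul, map_pow, map_smul] using h

theorem e₁_mem (q : k) : e₁ q ∈ component q 1 := by
  rw [component, pow_one]; exact Submodule.subset_span (by simp)

theorem e₂_mem (q : k) : e₂ q ∈ component q 1 := by
  rw [component, pow_one]; exact Submodule.subset_span (by simp)

instance gradedMonoid (q : k) : SetLike.GradedMonoid (component q) :=
  Submodule.nat_power_gradedMonoid (Submodule.span k {e₁ q, e₂ q})

/-- The algebra map `U⁺ → ⨁ U_n` placing `e₁` and `e₂` in degree one. -/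
noncomputable def toGraded (q : k) : UPlus q →ₐ[k] DirectSum ℕ (fun n => component q n) :=
  lift q (FreeAlgebra.lift k
    ![DirectSum.of (fun n => component q n) 1 ⟨e₁ q, e₁_mem q⟩,
      DirectSum.of (fun n => component q n) 1 ⟨e₂ q, e₂_mem q⟩]) (by
    rintro _ _ (_ | _)
    · have h := s1_eq q
      simp only [pow_succ, pow_zero, one_mul] at h
      simp only [map_add, map_smul, map_mul, map_pow, FreeAlgebra.lift_ι_apply]
      generalize hc : q ^ 2 + (q ^ 2)⁻¹ = c
      simp only [pow_succ, pow_zero, one_mul] at hc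
      rw [hc] at h
      simp only [pow_succ, pow_zero, one_mul, Matrix.cons_val_zero,
        Matrix.cons_val_one, DirectSum.of_mul_of]
      simp only [← DirectSum.lof_eq_of k, ← map_smul]
      refine (map_add (DirectSum.lof k ℕ (fun n => component q n) _) _ _).symm.trans
        (Eq.trans ?_ rfl)
      exact congrArg _ (Subtype.ext h)
    · have h := s2_eq q
      simp only [pow_succ, pow_zero, one_mul] at h
      simp only [map_add, map_smul, map_mul, map_pow, FreeAlgebra.lift_ι_apply]
      generalize hc : q ^ 2 + 1 + (q ^ 2)⁻¹ = c
      simp only [pow_succ, pow_zero, one_mul] at hc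
      rw [hc] at h
      simp only [pow_succ, pow_zero, one_mul, Matrix.cons_val_zero,
        Matrix.cons_val_one, DirectSum.of_mul_of]
      simp only [← DirectSum.lof_eq_of k, ← map_smul]
      refine (map_add (DirectSum.lof k ℕ (fun n => component q n) _) _ _).symm.trans
        (Eq.trans ?_ (map_add (DirectSum.lof k ℕ (fun n => component q n) _) _ _))
      exact congrArg _ (Subtype.ext h))

theorem toGraded_e₁ (q : k) : toGraded q (e₁ q) =
    DirectSum.of (fun n => component q n) 1 ⟨e₁ q, e₁_mem q⟩ := by
  exact (lift_mk q _ _ _).trans (FreeAlgebra.lift_ι_apply _ _)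

theorem toGraded_e₂ (q : k) : toGraded q (e₂ q) =
    DirectSum.of (fun n => component q n) 1 ⟨e₂ q, e₂_mem q⟩ := by
  exact (lift_mk q _ _ _).trans (FreeAlgebra.lift_ι_apply _ _)

/-- The components `U_n` form an algebra grading of `U⁺`. -/
noncomputable instance gradedAlgebra (q : k) : GradedAlgebra (component q) :=
  GradedAlgebra.ofAlgHom _ (toGraded q)
    (by
      apply hom_ext
      · change DirectSum.coeAlgHom (component q) (toGraded q (e₁ q)) = e₁ q
        rw [toGraded_e₁, DirectSum.coeAlgHom_of]
      · change DirectSum.coeAlgHom (component q) (toGraded q (e₂ q)) = e₂ q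
        rw [toGraded_e₂, DirectSum.coeAlgHom_of])
    fun i x => by
      obtain ⟨x, hx⟩ := x
      dsimp only [Subtype.coe_mk]
      induction hx using Submodule.pow_induction_on_left' with
      | algebraMap r =>
        rw [AlgHom.commutes, DirectSum.algebraMap_apply]; rfl
      | add x y i hx hy ihx ihy =>
        rw [map_add, ihx, ihy, ← map_add]; rfl
      | mem_mul m hm i x hx ih =>
        have key : ∀ hm' : m ∈ component q 1, toGraded q m =
            DirectSum.of (fun n => component q n) 1 ⟨m, hm'⟩ := by
          induction hm using Submodule.span_induction with
          | mem m h =>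
            intro hm'
            rcases h with rfl | h
            · exact toGraded_e₁ q
            · obtain rfl : m = e₂ q := h
              exact toGraded_e₂ q
          | zero => intro _; rw [map_zero]; exact (map_zero _).symm
          | add a b ha hb iha ihb =>
            intro _
            have ha' : a ∈ component q 1 := by rwa [component, pow_one]
            have hb' : b ∈ component q 1 := by rwa [component, pow_one]
            rw [map_add, iha ha', ihb hb', ← map_add]; rfl
          | smul r a ha iha =>
            intro _
            have ha' : a ∈ component q 1 := by rwa [component, pow_one]
            rw [map_smul, iha ha', ← DirectSum.lof_eq_of k, ← map_smul]; rfl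
        have hm' : m ∈ component q 1 := by rwa [component, pow_one]
        rw [map_mul, ih, key hm', DirectSum.of_mul_of]
        exact DirectSum.of_eq_of_gradedMonoid_eq (Sigma.subtype_ext (add_comm _ _) rfl)

end UqB2

/-! Centrality of `z` and `z'` is a computation, and central elements are normal; the content is
that a normal `f` lies in the subalgebra generated by `z` and `z'`. Inverting `e₃` and `w` should
turn `U⁺` into a quantum torus: with `x`, `y` the images of `e₃`, `w`, one has `y x = q² x y` while
`z`, `z'` become free central variables, and `e₁`, `e₂` can be solved for. `toTorus` is the
resulting map. The monomials `pbw` span `U⁺` (`span_pbw`) and their images have pairwise distinct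
leading exponents. Hence `toTorus` is injective, and every nonzero element of its image has leading
exponent of the form `pbwExp s`. This gives algebraic independence of `z`, `z'` and a test for
monomials outside the image. Let `f ≠ 0` be normal with image `F`. Conjugation by `F` keeps `x` and
`y` in the image up to scalars, by comparing largest and smallest exponents; as `q` is not a root of
unity, `F = x^i y^j P(z, z')`. Conjugation by `F` then scales the two terms of `e₁` by powers of
`q`, and likewise for `e₂`. If the two scalars differed, a single term would lie in the image, which
`pbwExp` excludes. This forces `j = 0` from `e₁` and `i = 0` from `e₂`. -/

namespace UqB2

/-! ### Monoid algebras twisted by a bicharacter. -/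

/-- A nowhere vanishing bicharacter on an additive monoid with values in a field. -/
structure Bicharacter (G k : Type*) [AddCommMonoid G] [Field k] where
  toFun : G → G → k
  add_left' : ∀ a b c, toFun (a + b) c = toFun a c * toFun b c
  add_right' : ∀ a b c, toFun a (b + c) = toFun a b * toFun a c
  ne_zero' : ∀ a b, toFun a b ≠ 0

namespace Bicharacter

variable {G k : Type*} [AddCommMonoid G] [Field k] (β : Bicharacter G k)

theorem zero_left (b : G) : β.toFun 0 b = 1 := by
  have h := β.add_left' 0 0 b
  rw [add_zero] at h
  exact (mul_left_cancel₀ (β.ne_zero' 0 b) (by rw [mul_one]; exact h)).symm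

theorem zero_right (a : G) : β.toFun a 0 = 1 := by
  have h := β.add_right' a 0 0
  rw [add_zero] at h
  exact (mul_left_cancel₀ (β.ne_zero' a 0) (by rw [mul_one]; exact h)).symm

end Bicharacter

/-- The monoid algebra of `G` over `k`, with multiplication twisted by the bicharacter `β`. -/
def TwistedAlgebra {G k : Type*} [AddCommMonoid G] [Field k] (_ : Bicharacter G k) : Type _ :=
  G →₀ k

namespace TwistedAlgebra

variable {G k : Type*} [AddCommMonoid G] [Field k] {β : Bicharacter G k}

noncomputable instance : AddCommGroup (TwistedAlgebra β) := inferInstanceAs (AddCommGroup (G →₀ k))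

noncomputable instance : Module k (TwistedAlgebra β) := inferInstanceAs (Module k (G →₀ k))

/-- The monomial with exponent `a` and coefficient `r`. -/
noncomputable def mono (β : Bicharacter G k) (a : G) : k →ₗ[k] TwistedAlgebra β :=
  Finsupp.lsingle a

/-- The coefficient at exponent `a`. -/
noncomputable def coeff (a : G) : TwistedAlgebra β →ₗ[k] k := Finsupp.lapply a

/-- The finite set of exponents with nonzero coefficient. -/
def supp (f : TwistedAlgebra β) : Finset G := Finsupp.support f

theorem mem_supp {f : TwistedAlgebra β} {a : G} : a ∈ f.supp ↔ coeff a f ≠ 0 :=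
  Finsupp.mem_support_iff

theorem ext_coeff {f g : TwistedAlgebra β} (h : ∀ a, coeff a f = coeff a g) : f = g :=
  Finsupp.ext h

theorem coeff_mono_self (a : G) (r : k) : coeff a (mono β a r) = r := Finsupp.single_eq_same

theorem coeff_mono_of_ne {a b : G} (h : b ≠ a) (r : k) : coeff b (mono β a r) = 0 :=
  Finsupp.single_eq_of_ne h

theorem lhom_ext {M : Type*} [AddCommMonoid M] [Module k M] {φ ψ : TwistedAlgebra β →ₗ[k] M}
    (h : ∀ a r, φ (mono β a r) = ψ (mono β a r)) : φ = ψ :=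
  Finsupp.lhom_ext h

theorem sum_supp (f : TwistedAlgebra β) : ∑ a ∈ f.supp, mono β a (coeff a f) = f :=
  Finsupp.sum_single f

/-- The linear map with prescribed values on monomials. -/
noncomputable def lsum {M : Type*} [AddCommMonoid M] [Module k M] (φ : G → k →ₗ[k] M) :
    TwistedAlgebra β →ₗ[k] M :=
  Finsupp.lsum k φ

theorem lsum_mono {M : Type*} [AddCommMonoid M] [Module k M] (φ : G → k →ₗ[k] M) (a : G) (r : k) :
    lsum φ (mono β a r) = φ a r :=
  Finsupp.lsum_single k φ a r

theorem induction_mono {p : TwistedAlgebra β → Prop} (f : TwistedAlgebra β) (zero : p 0)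
    (add : ∀ f g, p f → p g → p (f + g)) (mono : ∀ a r, p (mono β a r)) : p f :=
  Finsupp.induction_linear f zero add mono

/-- The bilinear map underlying multiplication. -/
noncomputable def mulLin (β : Bicharacter G k) :
    TwistedAlgebra β →ₗ[k] TwistedAlgebra β →ₗ[k] TwistedAlgebra β :=
  lsum fun a => LinearMap.flip (lsum fun b =>
    LinearMap.mk₂ k (fun s r => mono β (a + b) (β.toFun a b * (r * s)))
      (fun s s' r => by rw [← map_add]; congr 1; ring)
      (fun c s r => by rw [← map_smul]; congr 1; simp only [smul_eq_mul]; ring)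
      (fun s r r' => by rw [← map_add]; congr 1; ring)
      (fun c s r => by rw [← map_smul]; congr 1; simp only [smul_eq_mul]; ring))

noncomputable instance : Mul (TwistedAlgebra β) := ⟨fun f g => mulLin β f g⟩

noncomputable instance : One (TwistedAlgebra β) := ⟨mono β 0 1⟩

theorem mul_def (f g : TwistedAlgebra β) : f * g = mulLin β f g := rfl

theorem one_def : (1 : TwistedAlgebra β) = mono β 0 1 := rfl

theorem mono_mul_mono (a b : G) (r s : k) :
    mono β a r * mono β b s = mono β (a + b) (β.toFun a b * (r * s)) := by
  rw [mul_def, mulLin, lsum_mono, LinearMap.flip_apply, lsum_mono, LinearMap.mk₂_apply]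

theorem mulLin_one (f : TwistedAlgebra β) : mulLin β f 1 = f := by
  suffices h : (mulLin β).flip 1 = LinearMap.id from LinearMap.congr_fun h f
  refine lhom_ext fun a r => ?_
  rw [LinearMap.flip_apply, ← mul_def, one_def, mono_mul_mono, add_zero, β.zero_right, mul_one,
    one_mul, LinearMap.id_apply]

theorem one_mulLin (f : TwistedAlgebra β) : mulLin β 1 f = f := by
  suffices h : mulLin β 1 = LinearMap.id from LinearMap.congr_fun h f
  refine lhom_ext fun a r => ?_
  rw [← mul_def, one_def, mono_mul_mono, zero_add, β.zero_left, one_mul, one_mul,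
    LinearMap.id_apply]

theorem mulLin_assoc (f g h : TwistedAlgebra β) :
    mulLin β (mulLin β f g) h = mulLin β f (mulLin β g h) := by
  induction f using induction_mono with
  | zero => simp only [map_zero, LinearMap.zero_apply]
  | add f f' hf hf' => simp only [map_add, LinearMap.add_apply, hf, hf']
  | mono a r =>
    induction g using induction_mono with
    | zero => simp only [map_zero, LinearMap.zero_apply]
    | add g g' hg hg' => simp only [map_add, LinearMap.add_apply, hg, hg']
    | mono b s =>
      induction h using induction_mono with
      | zero => simp only [map_zero]
      | add h h' hh hh' => simp only [map_add, hh, hh']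
      | mono c t =>
        simp only [← mul_def, mono_mul_mono, β.add_left', β.add_right', add_assoc]
        congr 1
        ring

noncomputable instance : Ring (TwistedAlgebra β) :=
  { (inferInstance : AddCommGroup (TwistedAlgebra β)) with
    mul := (· * ·)
    one := 1
    left_distrib := fun f g h => map_add (mulLin β f) g h
    right_distrib := fun f g h => by simp only [mul_def, map_add, LinearMap.add_apply]
    zero_mul := fun f => by simp only [mul_def, map_zero, LinearMap.zero_apply]
    mul_zero := fun f => map_zero (mulLin β f)
    mul_assoc := mulLin_assoc
    one_mul := one_mulLin
    mul_one := mulLin_one }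

noncomputable instance : Algebra k (TwistedAlgebra β) :=
  Algebra.ofModule
    (fun r f g => by
      change mulLin β (r • f) g = r • mulLin β f g
      rw [map_smul, LinearMap.smul_apply])
    (fun r f g => by
      change mulLin β f (r • g) = r • mulLin β f g
      rw [map_smul])

theorem mono_smul (a : G) (r s : k) : s • mono β a r = mono β a (s * r) := by
  rw [← map_smul, smul_eq_mul]

theorem mul_eq_sum (f g : TwistedAlgebra β) : f * g = ∑ a ∈ f.supp, ∑ b ∈ g.supp,
    mono β (a + b) (β.toFun a b * (coeff a f * coeff b g)) := by
  conv_lhs => rw [← sum_supp f, ← sum_supp g]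
  simp only [Finset.sum_mul_sum, mono_mul_mono]

theorem exists_of_mem_supp_mul {f g : TwistedAlgebra β} {c : G} (h : c ∈ (f * g).supp) :
    ∃ a ∈ f.supp, ∃ b ∈ g.supp, a + b = c := by
  by_contra! H
  rw [mem_supp, mul_eq_sum, map_sum] at h
  refine h (Finset.sum_eq_zero fun a ha => ?_)
  rw [map_sum]
  exact Finset.sum_eq_zero fun b hb => coeff_mono_of_ne (H a ha b hb).symm _

/-- If only one pair of exponents contributes to `a + b`, no cancellation can occur. This serves
both leading terms and products with a monomial. -/
theorem coeff_mul_of_unique {f g : TwistedAlgebra β} {a b : G}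
    (H : ∀ a' ∈ f.supp, ∀ b' ∈ g.supp, a' + b' = a + b → a' = a ∧ b' = b) :
    coeff (a + b) (f * g) = β.toFun a b * (coeff a f * coeff b g) := by
  rw [mul_eq_sum, map_sum, Finset.sum_eq_single a, map_sum, Finset.sum_eq_single b,
    coeff_mono_self]
  · intro b' hb' hne
    by_cases ha : a ∈ f.supp
    · exact coeff_mono_of_ne (fun e => hne (H a ha b' hb' e.symm).2) _
    · rw [mem_supp, not_not] at ha
      rw [ha, zero_mul, mul_zero, map_zero, map_zero]
  · intro hb
    rw [mem_supp, not_not] at hb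
    rw [hb, mul_zero, mul_zero, map_zero, map_zero]
  · intro a' ha' hne
    rw [map_sum]
    exact Finset.sum_eq_zero fun b' hb' =>
      coeff_mono_of_ne (fun e => hne (H a' ha' b' hb' e.symm).1) _
  · intro ha
    rw [mem_supp, not_not] at ha
    simp only [ha, zero_mul, mul_zero, map_zero, Finset.sum_const_zero]

theorem supp_mono_subset (a : G) (r : k) : (mono β a r).supp ⊆ {a} := fun b hb => by
  rw [Finset.mem_singleton]
  by_contra hne
  exact mem_supp.1 hb (coeff_mono_of_ne hne r)

section Cancel

variable [IsCancelAdd G]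

theorem coeff_mul_mono (f : TwistedAlgebra β) (a b : G) (r : k) :
    coeff (a + b) (f * mono β b r) = β.toFun a b * (coeff a f * r) := by
  rw [coeff_mul_of_unique, coeff_mono_self]
  intro a' _ b' hb' e
  obtain rfl := Finset.mem_singleton.1 (supp_mono_subset _ _ hb')
  exact ⟨add_right_cancel e, rfl⟩

theorem coeff_mono_mul (f : TwistedAlgebra β) (a b : G) (r : k) :
    coeff (a + b) (mono β a r * f) = β.toFun a b * (r * coeff b f) := by
  rw [coeff_mul_of_unique, coeff_mono_self]
  intro a' ha' b' _ e
  obtain rfl := Finset.mem_singleton.1 (supp_mono_subset _ _ ha')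
  exact ⟨rfl, add_left_cancel e⟩

end Cancel

/-! ### Leading exponents, zero divisors and conjugates of monomials. -/

section Leading

variable {L : Type*} [LinearOrder L]

/-- `a` is the largest exponent of `f` with respect to the ordering of exponents by `o`. -/
def IsLeading (o : G → L) (f : TwistedAlgebra β) (a : G) : Prop :=
  a ∈ f.supp ∧ ∀ b ∈ f.supp, o b ≤ o a

theorem exists_isLeading (o : G → L) {f : TwistedAlgebra β} (hf : f ≠ 0) :
    ∃ a, IsLeading o f a := by
  have hne : f.supp.Nonempty := by
    rw [Finset.nonempty_iff_ne_empty]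
    intro h
    exact hf (by rw [← sum_supp f, h, Finset.sum_empty])
  obtain ⟨a, ha, h⟩ := f.supp.exists_max_image o hne
  exact ⟨a, ha, h⟩

theorem isLeading_mono (o : G → L) (a : G) {r : k} (hr : r ≠ 0) : IsLeading o (mono β a r) a := by
  refine ⟨mem_supp.2 (by rwa [coeff_mono_self]), fun b hb => ?_⟩
  rw [Finset.mem_singleton.1 (supp_mono_subset _ _ hb)]

theorem IsLeading.unique {o : G → L} (ho : Function.Injective o) {f : TwistedAlgebra β} {a b : G}
    (ha : IsLeading o f a) (hb : IsLeading o f b) : a = b :=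
  ho (le_antisymm (hb.2 a ha.1) (ha.2 b hb.1))

/-- In a linear combination of elements with distinct leading exponents, the largest of those
leading exponents survives. -/
theorem exists_isLeading_sum {ι : Type*} {o : G → L} (ho : Function.Injective o) (v : ι → TwistedAlgebra β)
    (d : ι → G) (hd : Function.Injective d) (hv : ∀ i, IsLeading o (v i) (d i)) (c : ι →₀ k)
    (hc : c ≠ 0) : ∃ i, IsLeading o (c.sum fun i r => r • v i) (d i) := by
  obtain ⟨i, hi, h⟩ := c.support.exists_max_image (fun i => o (d i))
    (Finsupp.support_nonempty_iff.2 hc)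
  refine ⟨i, ?_, fun b hb => ?_⟩
  · rw [mem_supp, Finsupp.sum, map_sum, Finset.sum_eq_single i]
    · rw [map_smul, smul_eq_mul]
      exact mul_ne_zero (Finsupp.mem_support_iff.1 hi) (mem_supp.1 (hv i).1)
    · intro j hj hne
      rw [map_smul, smul_eq_mul]
      by_contra H
      have hm := (hv j).2 _ (mem_supp.2 (right_ne_zero_of_mul H))
      exact hne (hd (ho (le_antisymm (h j hj) hm)))
    · intro hi'
      exact absurd hi hi'
  · rw [mem_supp, Finsupp.sum, map_sum] at hb
    obtain ⟨j, hj, hj'⟩ := Finset.exists_ne_zero_of_sum_ne_zero hb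
    rw [map_smul, smul_eq_mul] at hj'
    exact ((hv j).2 b (mem_supp.2 (right_ne_zero_of_mul hj'))).trans (h j hj)

variable [AddCommMonoid L] [IsOrderedCancelAddMonoid L] {o : G →+ L}

/-- The order is cancellative, so the sum of the two maxima is attained only by the maximal pair;
its coefficient survives because the bicharacter never vanishes. -/
theorem IsLeading.mul (ho : Function.Injective o) {f g : TwistedAlgebra β} {a b : G}
    (hf : IsLeading o f a) (hg : IsLeading o g b) : IsLeading o (f * g) (a + b) := by
  refine ⟨?_, fun c hc => ?_⟩
  · rw [mem_supp, coeff_mul_of_unique]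
    · exact mul_ne_zero (β.ne_zero' _ _) (mul_ne_zero (mem_supp.1 hf.1) (mem_supp.1 hg.1))
    · intro a' ha' b' hb' e
      have e' := congrArg o e
      rw [map_add, map_add] at e'
      obtain ⟨h₁, h₂⟩ := (add_eq_add_iff_eq_and_eq (hf.2 a' ha') (hg.2 b' hb')).1 e'
      exact ⟨ho h₁, ho h₂⟩
  · obtain ⟨a', ha', b', hb', rfl⟩ := exists_of_mem_supp_mul hc
    rw [map_add, map_add]
    exact add_le_add (hf.2 a' ha') (hg.2 b' hb')

theorem IsLeading.pow (ho : Function.Injective o) {f : TwistedAlgebra β} {a : G}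
    (hf : IsLeading o f a) (n : ℕ) : IsLeading o (f ^ n) (n • a) := by
  induction n with
  | zero =>
    rw [pow_zero, zero_nsmul]
    exact isLeading_mono o 0 one_ne_zero
  | succ n ih =>
    rw [pow_succ, succ_nsmul]
    exact ih.mul ho hf

theorem mul_ne_zero_of_ne_zero (ho : Function.Injective o) {f g : TwistedAlgebra β}
    (hf : f ≠ 0) (hg : g ≠ 0) : f * g ≠ 0 := by
  obtain ⟨a, ha⟩ := exists_isLeading o hf
  obtain ⟨b, hb⟩ := exists_isLeading o hg
  intro h
  have := (ha.mul ho hb).1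
  rw [h, mem_supp, map_zero] at this
  exact this rfl

/-- Leading exponents add, so that of `f` cancels from both sides. -/
theorem isLeading_of_mul_mono [IsCancelAdd G] (ho : Function.Injective o)
    {f g : TwistedAlgebra β} (hf : f ≠ 0) {a : G} {r : k} (hr : r ≠ 0)
    (h : g * f = f * mono β a r) : IsLeading o g a := by
  have hg : g ≠ 0 := by
    rintro rfl
    rw [zero_mul] at h
    refine mul_ne_zero_of_ne_zero ho hf ?_ h.symm
    intro h0
    have := coeff_mono_self (β := β) a r
    rw [h0, map_zero] at this
    exact hr this.symm
  obtain ⟨b, hb⟩ := exists_isLeading o hg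
  obtain ⟨c, hc⟩ := exists_isLeading o hf
  have h₁ := hb.mul ho hc
  have h₂ := hc.mul ho (isLeading_mono (β := β) o a hr)
  rw [h] at h₁
  have e := h₁.unique ho h₂
  rw [add_comm c a] at e
  rwa [add_right_cancel e] at hb

/-- An element conjugating a monomial to an element of the twisted algebra conjugates it to a
monomial with the same exponent. -/
theorem eq_mono_of_mul_mono [IsCancelAdd G] (ho : Function.Injective o)
    {f g : TwistedAlgebra β} (hf : f ≠ 0) {a : G} {r : k} (hr : r ≠ 0)
    (h : g * f = f * mono β a r) : g = mono β a (coeff a g) := by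
  have h₁ := isLeading_of_mul_mono ho hf hr h
  -- For the reversed order the same argument shows that `a` is also the smallest exponent of `g`.
  let o' : G →+ Lᵒᵈ :=
    { toFun := fun x => OrderDual.toDual (o x)
      map_zero' := congrArg _ (map_zero o)
      map_add' := fun x y => congrArg _ (map_add o x y) }
  have ho' : Function.Injective o' := fun x y e => ho (OrderDual.toDual.injective e)
  have h₂ := isLeading_of_mul_mono ho' hf hr h
  refine ext_coeff fun b => ?_
  by_cases hb : b = a
  · rw [hb, coeff_mono_self]
  · rw [coeff_mono_of_ne hb]
    by_contra H
    exact hb (ho (le_antisymm (h₁.2 b (mem_supp.2 H)) (h₂.2 b (mem_supp.2 H))))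

end Leading

end TwistedAlgebra

end UqB2

/-! ### Commutation relations, centrality of `z` and `z'`, spanning ordered monomials. -/

namespace UqB2

section Relations

variable {k : Type*} [Field k] (q : k)

theorem e₁_mul_e₂ : e₁ q * e₂ q = q ^ 2 • (e₂ q * e₁ q) + e₃ q := by
  rw [e₃, add_sub_cancel]

theorem e₂_mul_e₃ : e₂ q * e₃ q = q ^ 2 • (e₃ q * e₂ q) + z q := by
  rw [z, add_sub_cancel]

/-- Once `e₃` is invertible this can be solved for `e₂`, which is the source of the formula for
`tE₂`. -/
theorem w_eq : w q = z q + (q ^ 2 - 1) • (e₃ q * e₂ q) := by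
  rw [w, e₂_mul_e₃, sub_smul, one_smul]; abel

variable {q}

theorem mul_mul_of_eq {A : Type*} [Semigroup A] {a b c : A} (h : a * b = c) (x : A) :
    a * (b * x) = c * x := by rw [← mul_assoc, h]

/-- This is the first Serre relation after expanding `e₃`. -/
theorem e₁_mul_e₃ (hq : q ≠ 0) : e₁ q * e₃ q = (q ^ 2)⁻¹ • (e₃ q * e₁ q) := by
  have h := s1_eq q
  simp only [e₃, mul_sub, sub_mul, mul_smul_comm, smul_mul_assoc, mul_assoc, pow_succ, pow_zero,
    one_mul] at h ⊢
  linear_combination (norm := skip) h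
  match_scalars <;> field_simp <;> ring

/-- This is the second Serre relation, multiplied by `-q²`, after expanding `z` and `e₃`. -/
theorem e₂_mul_z (hq : q ≠ 0) : e₂ q * z q = z q * e₂ q := by
  have h := s2_eq q
  simp only [z, e₃, mul_sub, sub_mul, mul_smul_comm, smul_mul_assoc, mul_assoc, pow_succ, pow_zero,
    one_mul] at h ⊢
  linear_combination (norm := skip) (-q ^ 2) • h
  match_scalars <;> field_simp <;> ring

theorem e₁_mul_z (hq : q ≠ 0) : e₁ q * z q = z q * e₁ q := by
  have h₁₃ := e₁_mul_e₃ hq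
  have h₁₂ := e₁_mul_e₂ q
  simp only [z, mul_sub, sub_mul, mul_smul_comm, smul_mul_assoc, h₁₂, h₁₃, mul_assoc,
    mul_mul_of_eq h₁₂, mul_mul_of_eq h₁₃, add_mul, mul_add, smul_add]
  match_scalars <;> field_simp
  ring

/-- A subspace containing `1` and stable under left multiplication by `e₁` and `e₂` is everything. -/
theorem submodule_eq_top (V : Submodule k (UPlus q)) (h : 1 ∈ V) (h₁ : ∀ v ∈ V, e₁ q * v ∈ V)
    (h₂ : ∀ v ∈ V, e₂ q * v ∈ V) : V = ⊤ := by
  have key : ∀ x : FreeAlgebra k (Fin 2), ∀ v ∈ V, mk q x * v ∈ V := by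
    intro x
    induction x using FreeAlgebra.induction with
    | grade0 r =>
      intro v hv
      rw [AlgHom.commutes, ← Algebra.smul_def]
      exact V.smul_mem r hv
    | grade1 i =>
      fin_cases i
      · exact h₁
      · exact h₂
    | mul x y hx hy =>
      intro v hv
      rw [map_mul, mul_assoc]
      exact hx _ (hy v hv)
    | add x y hx hy =>
      intro v hv
      rw [map_add, add_mul]
      exact V.add_mem (hx v hv) (hy v hv)
  rw [eq_top_iff]
  rintro f -
  obtain ⟨x, rfl⟩ := RingQuot.mkAlgHom_surjective k (SerreRel q) f
  have := key x 1 h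
  rwa [mul_one] at this

theorem commute_of_generators {f : UPlus q} (h₁ : e₁ q * f = f * e₁ q) (h₂ : e₂ q * f = f * e₂ q)
    (g : UPlus q) : Commute f g := by
  have := submodule_eq_top (Subalgebra.toSubmodule (Subalgebra.centralizer k {f}))
    (one_mem (Subalgebra.centralizer k {f}))
    (fun v hv => (Subalgebra.centralizer k {f}).mul_mem
      (Subalgebra.mem_centralizer_iff k |>.2 (by rintro _ rfl; exact h₁.symm)) hv)
    (fun v hv => (Subalgebra.centralizer k {f}).mul_mem
      (Subalgebra.mem_centralizer_iff k |>.2 (by rintro _ rfl; exact h₂.symm)) hv)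
  have hg : g ∈ Subalgebra.toSubmodule (Subalgebra.centralizer k {f}) := this ▸ Submodule.mem_top
  exact (Subalgebra.mem_centralizer_iff k).1 hg f rfl

theorem commute_z (hq : q ≠ 0) (f : UPlus q) : Commute (z q) f :=
  commute_of_generators (e₁_mul_z hq) (e₂_mul_z hq) f

theorem e₃_mul_z (hq : q ≠ 0) : e₃ q * z q = z q * e₃ q := (commute_z hq _).eq.symm

/-- Moving `e₁` to the right through `w` leaves only a multiple of `e₃²`. With `w` invertible this
can be solved for `e₁`, which gives the formula for `tE₁`. -/
theorem z'_eq (hq : q ≠ 0) : z' q = (1 - (q ^ 4)⁻¹) • (w q * e₁ q)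
    + (1 - (q ^ 2)⁻¹) • (e₃ q * e₃ q) := by
  have h₁₃ := e₁_mul_e₃ hq
  have h₁₂ := e₁_mul_e₂ q
  have h₁ := e₁_mul_z hq
  simp only [z', w_eq, mul_smul_comm, smul_mul_assoc, h₁₂, mul_assoc,
    mul_mul_of_eq h₁₃, add_mul, mul_add, smul_add, h₁]
  match_scalars <;> field_simp

theorem e₁_mul_z' (hq : q ≠ 0) : e₁ q * z' q = z' q * e₁ q := by
  have h₁₃ := e₁_mul_e₃ hq
  have h₁₂ := e₁_mul_e₂ q
  have h₁ := e₁_mul_z hq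
  rw [z'_eq hq]
  simp only [w_eq, mul_smul_comm, smul_mul_assoc, h₁₃, mul_assoc,
    mul_mul_of_eq h₁₂, mul_mul_of_eq h₁₃, add_mul, mul_add, smul_add, mul_mul_of_eq h₁]
  match_scalars <;> field_simp
  ring

theorem e₂_mul_z' (hq : q ≠ 0) : e₂ q * z' q = z' q * e₂ q := by
  have h₂₃ := e₂_mul_e₃ q
  have h₁₂ := e₁_mul_e₂ q
  have h₂ := e₂_mul_z hq
  have h₃ := e₃_mul_z hq
  rw [z'_eq hq]
  simp only [w_eq, mul_smul_comm, smul_mul_assoc, h₁₂, h₂₃, mul_assoc,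
    mul_mul_of_eq h₂₃, add_mul, mul_add, smul_add, h₃, mul_mul_of_eq h₂]
  match_scalars <;> field_simp <;> ring

theorem commute_z' (hq : q ≠ 0) (f : UPlus q) : Commute (z' q) f :=
  commute_of_generators (e₁_mul_z' hq) (e₂_mul_z' hq) f

theorem z_mem_component : z q ∈ component q 3 := by
  have h₁ := e₁_mem q
  have h₂ := e₂_mem q
  have h₃ : e₃ q ∈ component q 2 :=
    Submodule.sub_mem _ (SetLike.mul_mem_graded h₁ h₂)
      (Submodule.smul_mem _ _ (SetLike.mul_mem_graded h₂ h₁))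
  exact Submodule.sub_mem _ (SetLike.mul_mem_graded h₂ h₃)
      (Submodule.smul_mem _ _ (SetLike.mul_mem_graded h₃ h₂))

theorem z'_mem_component : z' q ∈ component q 4 := by
  have h₁ := e₁_mem q
  have h₂ := e₂_mem q
  have h₃ : e₃ q ∈ component q 2 :=
    Submodule.sub_mem _ (SetLike.mul_mem_graded h₁ h₂)
      (Submodule.smul_mem _ _ (SetLike.mul_mem_graded h₂ h₁))
  have h₄ : w q ∈ component q 3 :=
    Submodule.sub_mem _ (SetLike.mul_mem_graded h₂ h₃) (SetLike.mul_mem_graded h₃ h₂)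
  exact Submodule.sub_mem _ (SetLike.mul_mem_graded h₁ h₄)
      (Submodule.smul_mem _ _ (SetLike.mul_mem_graded h₄ h₁))

variable (q) in
/-- The ordered monomial `z ^ a * e₃ ^ b * e₂ ^ c * e₁ ^ d` with exponents `(a, b, c, d)`. -/
noncomputable def pbw (s : ℕ × ℕ × ℕ × ℕ) : UPlus q :=
  z q ^ s.1 * (e₃ q ^ s.2.1 * (e₂ q ^ s.2.2.1 * e₁ q ^ s.2.2.2))

/-- A generator multiplied on the left is pushed right to its place. The only correction terms are
`z`, which is central, and `e₃`, which is created only when no other `e₃` stands to its left. -/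
theorem span_pbw (hq : q ≠ 0) : Submodule.span k (Set.range (pbw q)) = ⊤ := by
  set V := Submodule.span k (Set.range (pbw q)) with hV
  have stable : ∀ x : UPlus q, (∀ s, x * pbw q s ∈ V) → ∀ v ∈ V, x * v ∈ V := by
    intro x hx v hv
    have : V ≤ V.comap (LinearMap.mulLeft k x) := by
      rw [hV, Submodule.span_le]
      rintro _ ⟨s, rfl⟩
      exact hx s
    exact this hv
  have hmem : ∀ a b c d, z q ^ a * (e₃ q ^ b * (e₂ q ^ c * e₁ q ^ d)) ∈ V := fun a b c d =>
    Submodule.subset_span ⟨(a, b, c, d), rfl⟩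
  have hz : ∀ v ∈ V, z q * v ∈ V := stable _ (by
    rintro ⟨a, b, c, d⟩
    rw [pbw, ← mul_assoc, ← pow_succ']
    exact hmem _ _ _ _)
  have hzn : ∀ n : ℕ, ∀ v ∈ V, z q ^ n * v ∈ V := by
    intro n
    induction n with
    | zero => intro v hv; rwa [pow_zero, one_mul]
    | succ n ih => intro v hv; rw [pow_succ, mul_assoc]; exact ih _ (hz v hv)
  have h₃ : ∀ v ∈ V, e₃ q * v ∈ V := stable _ (by
    rintro ⟨a, b, c, d⟩
    rw [pbw, ← mul_assoc, ← ((commute_z hq (e₃ q)).pow_left a).eq, mul_assoc, ← mul_assoc (e₃ q),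
      ← pow_succ']
    exact hmem _ _ _ _)
  have h₂ : ∀ v ∈ V, e₂ q * v ∈ V := stable _ (by
    rintro ⟨a, b, c, d⟩
    rw [pbw, ← mul_assoc, ← ((commute_z hq (e₂ q)).pow_left a).eq, mul_assoc]
    refine hzn _ _ ?_
    dsimp only
    induction b with
    | zero =>
      have := hmem 0 0 (c + 1) d
      rw [pow_zero, one_mul]
      rwa [pow_succ', pow_zero, one_mul, pow_zero, one_mul, mul_assoc] at this
    | succ b ih =>
      have := hmem 0 b c d
      rw [pow_zero, one_mul] at this
      rw [pow_succ', mul_assoc, mul_mul_of_eq (e₂_mul_e₃ q), add_mul, smul_mul_assoc, mul_assoc]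
      exact V.add_mem (V.smul_mem _ (h₃ _ ih)) (hz _ this))
  have h₁ : ∀ v ∈ V, e₁ q * v ∈ V := stable _ (by
    rintro ⟨a, b, c, d⟩
    rw [pbw, ← mul_assoc, ← ((commute_z hq (e₁ q)).pow_left a).eq, mul_assoc]
    refine hzn _ _ ?_
    dsimp only
    induction b with
    | zero =>
      rw [pow_zero, one_mul]
      induction c with
      | zero =>
        have := hmem 0 0 0 (d + 1)
        rw [pow_succ'] at this
        simpa only [pow_zero, one_mul] using this
      | succ c ih =>
        have := hmem 0 1 c d
        rw [pow_zero, one_mul, pow_one] at this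
        rw [pow_succ', mul_assoc, mul_mul_of_eq (e₁_mul_e₂ q), add_mul, smul_mul_assoc, mul_assoc]
        exact V.add_mem (V.smul_mem _ (h₂ _ ih)) this
    | succ b ih =>
      rw [pow_succ', mul_assoc, mul_mul_of_eq (e₁_mul_e₃ hq), smul_mul_assoc, mul_assoc]
      exact V.smul_mem _ (h₃ _ ih))
  refine submodule_eq_top V ?_ h₁ h₂
  have := hmem 0 0 0 0
  simpa only [pow_zero, one_mul] using this

end Relations
end UqB2

/-! ### The map to the quantum torus. -/

namespace UqB2

variable {k : Type*} [Field k]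

open TwistedAlgebra

/-- The bicharacter on exponents `(i, j, m, n)` for which the monomials `x ^ i y ^ j z ^ m z' ^ n`
satisfy `y x = q ^ 2 x y`, with `z` and `z'` central. -/
def torusBichar (q : k) (hq : q ≠ 0) : Bicharacter (ℤ × ℤ × ℕ × ℕ) k where
  toFun a b := q ^ (2 * (a.2.1 * b.1))
  add_left' a b c := by rw [← zpow_add₀ hq]; congr 1; simp only [Prod.fst_add, Prod.snd_add]; ring
  add_right' a b c := by rw [← zpow_add₀ hq]; congr 1; simp only [Prod.fst_add]; ring
  ne_zero' a b := zpow_ne_zero _ hq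

/-- The quantum torus with central polynomial variables. -/
abbrev Torus (q : k) (hq : q ≠ 0) : Type _ := TwistedAlgebra (torusBichar q hq)

/-- The monomial `x ^ i y ^ j z ^ m z' ^ n`. -/
noncomputable def tmono (q : k) (hq : q ≠ 0) (i j : ℤ) (m n : ℕ) : Torus q hq :=
  mono (torusBichar q hq) (i, j, m, n) 1

theorem smul_tmono (q : k) (hq : q ≠ 0) (i j : ℤ) (m n : ℕ) (r : k) :
    r • tmono q hq i j m n = mono (torusBichar q hq) (i, j, m, n) r := by
  rw [tmono, mono_smul, mul_one]

theorem tmono_mul_tmono (q : k) (hq : q ≠ 0) (i j : ℤ) (m n : ℕ) (i' j' : ℤ) (m' n' : ℕ) :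
    tmono q hq i j m n * tmono q hq i' j' m' n' =
      q ^ (2 * (j * i')) • tmono q hq (i + i') (j + j') (m + m') (n + n') := by
  rw [smul_tmono, tmono, tmono, mono_mul_mono, mul_one, mul_one]
  rfl

/-- The image of `e₁` in the quantum torus. -/
noncomputable def tE₁ (q : k) (hq : q ≠ 0) : Torus q hq :=
  (q ^ 4 * (q ^ 4 - 1)⁻¹) • tmono q hq 0 (-1) 0 1 - (q ^ 2 * (q ^ 2 + 1))⁻¹ • tmono q hq 2 (-1) 0 0

/-- The image of `e₂` in the quantum torus. -/
noncomputable def tE₂ (q : k) (hq : q ≠ 0) : Torus q hq :=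
  (q ^ 2 - 1)⁻¹ • tmono q hq (-1) 1 0 0 - (q ^ 2 - 1)⁻¹ • tmono q hq (-1) 0 1 0

variable {q : k}

theorem sq_sub_one_ne_zero (h4 : q ^ 4 ≠ 1) : q ^ 2 - 1 ≠ 0 :=
  fun h => h4 (by linear_combination (q ^ 2 + 1) * h)

theorem sq_add_one_ne_zero (h4 : q ^ 4 ≠ 1) : q ^ 2 + 1 ≠ 0 :=
  fun h => h4 (by linear_combination (q ^ 2 - 1) * h)

variable (hq : q ≠ 0)

theorem torus_e₃ (h4 : q ^ 4 ≠ 1) :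
    tE₁ q hq * tE₂ q hq - q ^ 2 • (tE₂ q hq * tE₁ q hq) = tmono q hq 1 0 0 0 := by
  have h2 := sq_sub_one_ne_zero h4
  have h2' := sq_add_one_ne_zero h4
  have h4' : q ^ 4 - 1 ≠ 0 := sub_ne_zero.2 h4
  simp only [tE₁, tE₂, mul_sub, sub_mul, smul_mul_assoc, mul_smul_comm, tmono_mul_tmono, smul_smul,
    smul_sub]
  norm_num
  match_scalars <;> field_simp <;> ring

theorem torus_e₁_mul_e₃ : tE₁ q hq * tmono q hq 1 0 0 0
    = (q ^ 2)⁻¹ • (tmono q hq 1 0 0 0 * tE₁ q hq) := by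
  simp only [tE₁, mul_sub, sub_mul, smul_mul_assoc, mul_smul_comm, tmono_mul_tmono, smul_smul,
    smul_sub]
  norm_num
  match_scalars <;> field_simp

theorem torus_z (h4 : q ^ 4 ≠ 1) : tE₂ q hq * tmono q hq 1 0 0 0 -
    q ^ 2 • (tmono q hq 1 0 0 0 * tE₂ q hq) = tmono q hq 0 0 1 0 := by
  have h2 := sq_sub_one_ne_zero h4
  simp only [tE₂, mul_sub, sub_mul, smul_mul_assoc, mul_smul_comm, tmono_mul_tmono, smul_smul,
    smul_sub]
  norm_num
  match_scalars <;> field_simp <;> ring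

theorem torus_w (h4 : q ^ 4 ≠ 1) : tE₂ q hq * tmono q hq 1 0 0 0 -
    tmono q hq 1 0 0 0 * tE₂ q hq = tmono q hq 0 1 0 0 := by
  have h2 := sq_sub_one_ne_zero h4
  simp only [tE₂, mul_sub, sub_mul, smul_mul_assoc, mul_smul_comm, tmono_mul_tmono, smul_smul]
  norm_num
  match_scalars
  field_simp

theorem torus_z' (h4 : q ^ 4 ≠ 1) : tE₁ q hq * tmono q hq 0 1 0 0 -
    (q ^ 4)⁻¹ • (tmono q hq 0 1 0 0 * tE₁ q hq) = tmono q hq 0 0 0 1 := by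
  have h2 := sq_sub_one_ne_zero h4
  have h2' := sq_add_one_ne_zero h4
  have h4' : q ^ 4 - 1 ≠ 0 := sub_ne_zero.2 h4
  simp only [tE₁, mul_sub, sub_mul, smul_mul_assoc, mul_smul_comm, tmono_mul_tmono, smul_smul,
    smul_sub]
  norm_num
  match_scalars <;> field_simp
  ring

theorem torus_e₂_mul_z : tE₂ q hq * tmono q hq 0 0 1 0 = tmono q hq 0 0 1 0 * tE₂ q hq := by
  simp only [tE₂, mul_sub, sub_mul, smul_mul_assoc, mul_smul_comm, tmono_mul_tmono]
  norm_num

/-- The algebra map from `U⁺` to the quantum torus. -/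
noncomputable def toTorus (hq : q ≠ 0) (h4 : q ^ 4 ≠ 1) : UPlus q →ₐ[k] Torus q hq :=
  lift q (FreeAlgebra.lift k ![tE₁ q hq, tE₂ q hq]) (by
    have h₃ := torus_e₃ hq h4
    have h₁₃ := torus_e₁_mul_e₃ hq
    have hz := torus_z hq h4
    have h₂ := torus_e₂_mul_z hq
    -- The Serre relations amount to `e₁ e₃ = q⁻² e₃ e₁` and `e₂ z = z e₂`, so it suffices to have
    -- these two identities in the torus, expanded in `tE₁` and `tE₂`.
    rw [← hz, ← h₃] at h₂
    rw [← h₃] at h₁₃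
    rintro _ _ (_ | _)
    · simp only [map_add, map_smul, map_mul, map_pow, FreeAlgebra.lift_ι_apply, Matrix.cons_val_zero,
        Matrix.cons_val_one]
      simp only [mul_sub, sub_mul, mul_smul_comm, smul_mul_assoc, mul_assoc, pow_succ, pow_zero,
        one_mul] at h₁₃ ⊢
      linear_combination (norm := skip) h₁₃
      match_scalars <;> field_simp <;> ring
    · simp only [map_add, map_smul, map_mul, map_pow, FreeAlgebra.lift_ι_apply, Matrix.cons_val_zero,
        Matrix.cons_val_one]
      simp only [mul_sub, sub_mul, mul_smul_comm, smul_mul_assoc, mul_assoc, pow_succ, pow_zero,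
        one_mul] at h₂ ⊢
      linear_combination (norm := skip) (-(q ^ 2)⁻¹) • h₂
      match_scalars <;> field_simp <;> ring)

variable (h4 : q ^ 4 ≠ 1)

theorem toTorus_e₁ : toTorus hq h4 (e₁ q) = tE₁ q hq :=
  (lift_mk q _ _ _).trans (FreeAlgebra.lift_ι_apply _ _)

theorem toTorus_e₂ : toTorus hq h4 (e₂ q) = tE₂ q hq :=
  (lift_mk q _ _ _).trans (FreeAlgebra.lift_ι_apply _ _)

theorem toTorus_e₃ : toTorus hq h4 (e₃ q) = tmono q hq 1 0 0 0 := by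
  rw [e₃, map_sub, map_smul, map_mul, map_mul, toTorus_e₁, toTorus_e₂, torus_e₃ hq h4]

theorem toTorus_z : toTorus hq h4 (z q) = tmono q hq 0 0 1 0 := by
  rw [z, map_sub, map_smul, map_mul, map_mul, toTorus_e₃, toTorus_e₂, torus_z hq h4]

theorem toTorus_w : toTorus hq h4 (w q) = tmono q hq 0 1 0 0 := by
  rw [w, map_sub, map_mul, map_mul, toTorus_e₃, toTorus_e₂, torus_w hq h4]

theorem toTorus_z' : toTorus hq h4 (z' q) = tmono q hq 0 0 0 1 := by
  rw [z', map_sub, map_smul, map_mul, map_mul, toTorus_w, toTorus_e₁, torus_z' hq h4]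

theorem toTorus_z_pow_mul_z'_pow (m n : ℕ) :
    toTorus hq h4 (z q ^ m * z' q ^ n) = tmono q hq 0 0 m n := by
  have h₁ : tmono q hq 0 0 1 0 ^ m = tmono q hq 0 0 m 0 := by
    induction m with
    | zero => rfl
    | succ m ih => rw [pow_succ, ih, tmono_mul_tmono]; simp
  have h₂ : tmono q hq 0 0 0 1 ^ n = tmono q hq 0 0 0 n := by
    induction n with
    | zero => rfl
    | succ n ih => rw [pow_succ, ih, tmono_mul_tmono]; simp
  rw [map_mul, map_pow, map_pow, toTorus_z, toTorus_z', h₁, h₂, tmono_mul_tmono]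
  simp

/-! ### Leading exponents of the image and injectivity. -/

/-- The ordering of exponents: lexicographic in the exponents of `z'`, `y`, `x`, `z`. -/
def expOrd : ℤ × ℤ × ℕ × ℕ →+ ℕ ×ₗ ℤ ×ₗ ℤ ×ₗ ℕ where
  toFun a := toLex (a.2.2.2, toLex (a.2.1, toLex (a.1, a.2.2.1)))
  map_zero' := rfl
  map_add' _ _ := rfl

theorem expOrd_injective : Function.Injective expOrd := by
  rintro ⟨i, j, m, n⟩ ⟨i', j', m', n'⟩ h
  have h' := congrArg ofLex h
  have h₁ := congrArg Prod.fst h'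
  have h'' := congrArg ofLex (congrArg Prod.snd h')
  have h₂ := congrArg Prod.fst h''
  have h''' := congrArg ofLex (congrArg Prod.snd h'')
  have h₃ := congrArg Prod.fst h'''
  have h₄ := congrArg Prod.snd h'''
  simp only [expOrd] at h₁ h₂ h₃ h₄
  subst h₁ h₂ h₃ h₄
  rfl

theorem isLeading_sub {a b : ℤ × ℤ × ℕ × ℕ} (hab : expOrd b < expOrd a) {r s : k} (hr : r ≠ 0)
    (f : Torus q hq) (hf : f = mono _ a r - mono _ b s) : IsLeading expOrd f a := by
  subst hf
  have hne : a ≠ b := by rintro rfl; exact lt_irrefl _ hab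
  refine ⟨?_, fun c hc => ?_⟩
  · rw [mem_supp, map_sub, coeff_mono_self, coeff_mono_of_ne hne, sub_zero]
    exact hr
  · by_cases ha : c = a
    · rw [ha]
    · by_cases hb : c = b
      · rw [hb]; exact hab.le
      · rw [mem_supp, map_sub, coeff_mono_of_ne ha, coeff_mono_of_ne hb, sub_zero] at hc
        exact absurd rfl hc

/-- Ranking `z'` first makes `y⁻¹ z'` lead here; ranking `y` next makes `x⁻¹ y` lead in `tE₂`. These
choices make `pbwExp` injective. -/
theorem isLeading_tE₁ (h4 : q ^ 4 ≠ 1) : IsLeading expOrd (tE₁ q hq) (0, -1, 0, 1) := by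
  refine isLeading_sub hq (b := (2, -1, 0, 0)) ?_ (r := q ^ 4 * (q ^ 4 - 1)⁻¹)
    (s := (q ^ 2 * (q ^ 2 + 1))⁻¹) ?_ _ ?_
  · exact Prod.Lex.toLex_lt_toLex.2 (Or.inl (by decide))
  · exact mul_ne_zero (pow_ne_zero _ hq) (inv_ne_zero (sub_ne_zero.2 h4))
  · rw [tE₁, smul_tmono, smul_tmono]

theorem isLeading_tE₂ (h4 : q ^ 4 ≠ 1) : IsLeading expOrd (tE₂ q hq) (-1, 1, 0, 0) := by
  refine isLeading_sub hq (b := (-1, 0, 1, 0)) ?_ (r := (q ^ 2 - 1)⁻¹) (s := (q ^ 2 - 1)⁻¹) ?_ _ ?_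
  · exact Prod.Lex.toLex_lt_toLex.2 (Or.inr ⟨rfl, Prod.Lex.toLex_lt_toLex.2 (Or.inl (by decide))⟩)
  · exact inv_ne_zero (sq_sub_one_ne_zero h4)
  · rw [tE₂, smul_tmono, smul_tmono]

/-- The leading exponent of the image of an ordered monomial. -/
def pbwExp (s : ℕ × ℕ × ℕ × ℕ) : ℤ × ℤ × ℕ × ℕ :=
  (s.2.1 - s.2.2.1, s.2.2.1 - s.2.2.2, s.1, s.2.2.2)

theorem pbwExp_injective : Function.Injective pbwExp := by
  rintro ⟨a, b, c, d⟩ ⟨a', b', c', d'⟩ h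
  simp only [pbwExp, Prod.mk.injEq] at h ⊢
  omega

theorem isLeading_pbw (s : ℕ × ℕ × ℕ × ℕ) :
    IsLeading expOrd (toTorus hq h4 (pbw q s)) (pbwExp s) := by
  have hx : IsLeading expOrd (tmono q hq 1 0 0 0) (1, 0, 0, 0) := isLeading_mono _ _ one_ne_zero
  have hz : IsLeading expOrd (tmono q hq 0 0 1 0) (0, 0, 1, 0) := isLeading_mono _ _ one_ne_zero
  have ho := expOrd_injective
  have h := (hz.pow ho s.1).mul ho ((hx.pow ho s.2.1).mul ho
    (((isLeading_tE₂ hq h4).pow ho s.2.2.1).mul ho ((isLeading_tE₁ hq h4).pow ho s.2.2.2)))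
  rw [pbw, map_mul, map_mul, map_mul, map_pow, map_pow, map_pow, map_pow, toTorus_z, toTorus_e₃,
    toTorus_e₂, toTorus_e₁]
  convert h using 1
  simp only [pbwExp, Prod.smul_mk, Prod.mk_add_mk, smul_eq_mul, Prod.mk.injEq, nsmul_eq_mul]
  refine ⟨?_, ?_, ?_, ?_⟩ <;> ring

/-- Since distinct ordered monomials have distinct leading exponents, the largest one in a
combination cannot cancel. Spanning alone suffices; linear independence is a consequence. -/
theorem exists_isLeading_toTorus {f : UPlus q} (hf : f ≠ 0) :
    ∃ s, IsLeading expOrd (toTorus hq h4 f) (pbwExp s) := by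
  have hmem : f ∈ Submodule.span k (Set.range (pbw q)) := span_pbw hq ▸ Submodule.mem_top
  obtain ⟨c, rfl⟩ := Finsupp.mem_span_range_iff_exists_finsupp.1 hmem
  have hc : c ≠ 0 := by
    rintro rfl
    exact hf Finsupp.sum_zero_index
  obtain ⟨s, hs⟩ := exists_isLeading_sum expOrd_injective (fun s => toTorus hq h4 (pbw q s)) pbwExp
    pbwExp_injective (isLeading_pbw hq h4) c hc
  refine ⟨s, ?_⟩
  simpa only [Finsupp.sum, map_sum, map_smul] using hs

theorem toTorus_injective : Function.Injective (toTorus hq h4) := by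
  rw [injective_iff_map_eq_zero]
  intro f hf
  by_contra hne
  obtain ⟨s, hs⟩ := exists_isLeading_toTorus hq h4 hne
  have := hs.1
  rw [hf, mem_supp, map_zero] at this
  exact this rfl

/-- A monomial in the image of `U⁺` has the exponent of an ordered monomial. -/
theorem exists_pbwExp_of_toTorus_eq_mono {f : UPlus q} {a : ℤ × ℤ × ℕ × ℕ} {r : k} (hr : r ≠ 0)
    (h : toTorus hq h4 f = mono _ a r) : ∃ s, a = pbwExp s := by
  have hf : f ≠ 0 := by
    rintro rfl
    have := coeff_mono_self (β := torusBichar q hq) a r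
    rw [← h, map_zero, map_zero] at this
    exact hr this.symm
  obtain ⟨s, hs⟩ := exists_isLeading_toTorus hq h4 hf
  rw [h] at hs
  exact ⟨s, (isLeading_mono expOrd a hr).unique expOrd_injective hs⟩

end UqB2

/-! ### Normal elements and the center. -/

namespace UqB2

variable {k : Type*} [Field k] {q : k}

open TwistedAlgebra

theorem eq_zero_of_zpow_eq_one (hq : ∀ n : ℕ, 0 < n → q ^ n ≠ 1) {i : ℤ}
    (h : q ^ i = 1) : i = 0 := by
  by_contra hi
  rcases Int.natAbs_eq i with e | e
  · rw [e, zpow_natCast] at h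
    exact hq _ (Int.natAbs_pos.2 hi) h
  · rw [e, zpow_neg, inv_eq_one, zpow_natCast] at h
    exact hq _ (Int.natAbs_pos.2 hi) h

/-- Such an `F` is `x^i y^j` times a polynomial in the central variables, so commuting it past a
monomial costs a single power of `q`. -/
theorem torus_mul_mono (hq0 : q ≠ 0) {F : Torus q hq0} {i j : ℤ}
    (hF : ∀ a ∈ F.supp, a.1 = i ∧ a.2.1 = j) (d : ℤ × ℤ × ℕ × ℕ) (r : k) :
    F * mono _ d r = mono _ d (q ^ (2 * (j * d.1 - d.2.1 * i)) * r) * F := by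
  conv_lhs => rw [← sum_supp F]
  conv_rhs => rw [← sum_supp F]
  rw [Finset.sum_mul, Finset.mul_sum]
  refine Finset.sum_congr rfl fun a ha => ?_
  obtain ⟨h₁, h₂⟩ := hF a ha
  rw [mono_mul_mono, mono_mul_mono, add_comm d a]
  congr 1
  simp only [torusBichar, h₁, h₂, mul_sub, zpow_sub₀ hq0]
  have := zpow_ne_zero (2 * (d.2.1 * i)) hq0
  field_simp

/-- A normal element quasi-commutes with any element mapping to a monomial of the torus. -/
theorem exists_scalar_of_normal (hq0 : q ≠ 0) (h4 : q ^ 4 ≠ 1) {f : UPlus q} (hf : f ≠ 0)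
    (hN : IsNormalElement f) {u : UPlus q} {d : ℤ × ℤ × ℕ × ℕ}
    (hu : toTorus hq0 h4 u = mono _ d 1) :
    ∃ r : k, ∀ a ∈ (toTorus hq0 h4 f).supp, q ^ (2 * (a.2.1 * d.1)) = q ^ (2 * (d.2.1 * a.1)) * r := by
  obtain ⟨g, hg⟩ : f * u ∈ Set.range (fun b => b * f) := hN ▸ ⟨u, rfl⟩
  have h := congrArg (toTorus hq0 h4) hg
  simp only [map_mul] at h
  rw [hu] at h
  have hF : toTorus hq0 h4 f ≠ 0 := fun h0 =>
    hf (toTorus_injective hq0 h4 (h0.trans (map_zero _).symm))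
  have hG := eq_mono_of_mul_mono expOrd_injective hF one_ne_zero h
  refine ⟨coeff d (toTorus hq0 h4 g), fun a ha => ?_⟩
  have hc := congrArg (coeff (d + a)) h
  rw [hG, coeff_mono_mul, add_comm d a, coeff_mul_mono, mul_one, ← mul_assoc] at hc
  exact (mul_right_cancel₀ (mem_supp.1 ha) hc).symm

/-- A nonzero normal element has an image in which the exponents of `x` and `y` are constant. -/
theorem exists_exponents_of_normal (hq0 : q ≠ 0) (hq : ∀ n : ℕ, 0 < n → q ^ n ≠ 1)
    {f : UPlus q} (hf : f ≠ 0) (hN : IsNormalElement f) :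
    ∃ i j : ℤ, ∀ a ∈ (toTorus hq0 (hq 4 (by norm_num)) f).supp, a.1 = i ∧ a.2.1 = j := by
  have h4 := hq 4 (by norm_num)
  have hF : toTorus hq0 h4 f ≠ 0 := fun h0 =>
    hf (toTorus_injective hq0 h4 (h0.trans (map_zero _).symm))
  obtain ⟨b, hb⟩ := exists_isLeading expOrd hF
  -- Commuting with `x` detects the exponent of `y`, and commuting with `y`, the image of `w`,
  -- detects that of `x`.
  obtain ⟨r, hr⟩ := exists_scalar_of_normal hq0 h4 hf hN (toTorus_e₃ hq0 h4)
  obtain ⟨s, hs⟩ := exists_scalar_of_normal hq0 h4 hf hN (toTorus_w hq0 h4)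
  refine ⟨b.1, b.2.1, fun a ha => ⟨?_, ?_⟩⟩
  · have h₁ := hs a ha
    have h₂ := hs b hb.1
    simp only [mul_zero, zpow_zero, one_mul] at h₁ h₂
    have h : q ^ (2 * a.1 - 2 * b.1) = 1 := by
      rw [zpow_sub₀ hq0, div_eq_one_iff_eq (zpow_ne_zero _ hq0)]
      exact mul_right_cancel₀ (right_ne_zero_of_mul (h₁ ▸ one_ne_zero)) (h₁.symm.trans h₂)
    have := eq_zero_of_zpow_eq_one hq h
    omega
  · have h₁ := hr a ha
    have h₂ := hr b hb.1
    simp only [mul_one, zero_mul, mul_zero, zpow_zero, one_mul] at h₁ h₂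
    have h : q ^ (2 * a.2.1 - 2 * b.2.1) = 1 := by
      rw [zpow_sub₀ hq0, div_eq_one_iff_eq (zpow_ne_zero _ hq0), h₁, h₂]
    have := eq_zero_of_zpow_eq_one hq h
    omega

/-- If `f` is normal then conjugation by the image of `f` sends an element of the image of `U⁺`
with two terms to an element of the image of `U⁺`; a difference of the conjugate and a multiple of
the original element is a monomial. -/
theorem zpow_eq_of_normal (hq0 : q ≠ 0) (h4 : q ^ 4 ≠ 1) {f : UPlus q} (hf : f ≠ 0)
    (hN : IsNormalElement f) {i j : ℤ} (hij : ∀ a ∈ (toTorus hq0 h4 f).supp, a.1 = i ∧ a.2.1 = j)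
    {u : UPlus q} {d d' : ℤ × ℤ × ℕ × ℕ} {r r' : k} (hr' : r' ≠ 0)
    (hu : toTorus hq0 h4 u = mono _ d r - mono _ d' r') (hd' : ∀ s, d' ≠ pbwExp s) :
    q ^ (2 * (j * d.1 - d.2.1 * i)) = q ^ (2 * (j * d'.1 - d'.2.1 * i)) := by
  obtain ⟨g, hg⟩ : f * u ∈ Set.range (fun b => b * f) := hN ▸ ⟨u, rfl⟩
  have h := congrArg (toTorus hq0 h4) hg
  have hF : toTorus hq0 h4 f ≠ 0 := fun h0 =>
    hf (toTorus_injective hq0 h4 (h0.trans (map_zero _).symm))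
  simp only [map_mul] at h
  rw [hu, mul_sub, torus_mul_mono hq0 hij, torus_mul_mono hq0 hij, ← sub_mul, ← sub_eq_zero,
    ← sub_mul] at h
  have hG : toTorus hq0 h4 g = mono _ d (q ^ (2 * (j * d.1 - d.2.1 * i)) * r) -
      mono _ d' (q ^ (2 * (j * d'.1 - d'.2.1 * i)) * r') := by
    by_contra hne
    exact mul_ne_zero_of_ne_zero expOrd_injective (sub_ne_zero.2 hne) hF h
  by_contra hne
  have key : toTorus hq0 h4 (g - q ^ (2 * (j * d.1 - d.2.1 * i)) • u) =
      mono _ d' ((q ^ (2 * (j * d.1 - d.2.1 * i)) - q ^ (2 * (j * d'.1 - d'.2.1 * i))) * r') := by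
    rw [map_sub, map_smul, hG, hu, smul_sub, mono_smul, mono_smul, sub_mul, map_sub]
    abel
  obtain ⟨s, hs⟩ := exists_pbwExp_of_toTorus_eq_mono hq0 h4
    (mul_ne_zero (sub_ne_zero.2 hne) hr') key
  exact hd' s hs

theorem mem_adjoin_of_normal (hq0 : q ≠ 0) (hq : ∀ n : ℕ, 0 < n → q ^ n ≠ 1) {f : UPlus q}
    (hN : IsNormalElement f) : f ∈ Algebra.adjoin k {z q, z' q} := by
  by_cases hf : f = 0
  · rw [hf]; exact zero_mem _
  have h4 := hq 4 (by norm_num)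
  have h2' := sq_add_one_ne_zero h4
  obtain ⟨i, j, hij⟩ := exists_exponents_of_normal hq0 hq hf hN
  -- The two terms of `tE₁` are scaled by `q^(2i)` and `q^(4j+2i)`. The term `x² y⁻¹` has no `z'`,
  -- so as a `pbwExp` it would need exponent `-1` on `e₂`.
  have hj : j = 0 := by
    have h := zpow_eq_of_normal hq0 h4 hf hN hij (u := e₁ q) (d := (0, -1, 0, 1))
      (d' := (2, -1, 0, 0)) (inv_ne_zero (mul_ne_zero (pow_ne_zero 2 hq0) h2'))
      (by rw [toTorus_e₁, tE₁, smul_tmono, smul_tmono]) (by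
        rintro ⟨a, b, c, d⟩ h
        simp only [pbwExp, Prod.mk.injEq] at h
        omega)
    rw [← div_eq_one_iff_eq (zpow_ne_zero _ hq0), ← zpow_sub₀ hq0] at h
    have := eq_zero_of_zpow_eq_one hq h
    dsimp only at this
    omega
  -- The two terms of `tE₂` are scaled by `q^(-2j-2i)` and `q^(-2j)`. For `x⁻¹ z` the exponents of
  -- `e₁` and `e₂` would vanish and that of `e₃` would be `-1`.
  have hi : i = 0 := by
    have h := zpow_eq_of_normal hq0 h4 hf hN hij (u := e₂ q) (d := (-1, 1, 0, 0))
      (d' := (-1, 0, 1, 0)) (inv_ne_zero (sq_sub_one_ne_zero h4))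
      (by rw [toTorus_e₂, tE₂, smul_tmono, smul_tmono]) (by
        rintro ⟨a, b, c, d⟩ h
        simp only [pbwExp, Prod.mk.injEq] at h
        omega)
    rw [← div_eq_one_iff_eq (zpow_ne_zero _ hq0), ← zpow_sub₀ hq0] at h
    have := eq_zero_of_zpow_eq_one hq h
    dsimp only at this
    omega
  subst hi hj
  have hmem : toTorus hq0 h4 f ∈ (Algebra.adjoin k {z q, z' q}).map (toTorus hq0 h4) := by
    rw [← sum_supp (toTorus hq0 h4 f)]
    refine Subalgebra.sum_mem _ fun a ha => ?_
    obtain ⟨h₁, h₂⟩ := hij a ha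
    obtain ⟨i, j, m, n⟩ := a
    dsimp only at h₁ h₂
    subst h₁ h₂
    rw [← smul_tmono, ← toTorus_z_pow_mul_z'_pow hq0 h4, ← map_smul]
    refine ⟨_, Subalgebra.smul_mem _ (Subalgebra.mul_mem _ (Subalgebra.pow_mem _ ?_ _)
      (Subalgebra.pow_mem _ ?_ _)) _, rfl⟩
    · exact Algebra.subset_adjoin (Or.inl rfl)
    · exact Algebra.subset_adjoin (Or.inr rfl)
  obtain ⟨g, hg, e⟩ := hmem
  exact toTorus_injective hq0 h4 e ▸ hg

theorem adjoin_le_center (hq0 : q ≠ 0) :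
    Algebra.adjoin k {z q, z' q} ≤ Subalgebra.center k (UPlus q) := by
  rw [Algebra.adjoin_le_iff]
  rintro _ (rfl | rfl)
  · exact Subalgebra.mem_center_iff.2 fun b => (commute_z hq0 b).eq.symm
  · exact Subalgebra.mem_center_iff.2 fun b => (commute_z' hq0 b).eq.symm

theorem isNormalElement_of_mem_center {f : UPlus q} (hf : f ∈ Subalgebra.center k (UPlus q)) :
    IsNormalElement f :=
  congrArg Set.range (funext fun b => (Subalgebra.mem_center_iff.1 hf b).symm)

/-- `z` and `z'`, as elements of the center, are algebraically independent. -/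
theorem aeval_injective (hq0 : q ≠ 0) (h4 : q ^ 4 ≠ 1) {x y : Subalgebra.center k (UPlus q)}
    (hx : (x : UPlus q) = z q) (hy : (y : UPlus q) = z' q) :
    Function.Injective (MvPolynomial.aeval (R := k) ![x, y]) := by
  -- Since `z^m z'^n` maps to a basis monomial of the torus, the coefficients of `p` can be read off
  -- from the image of its value.
  have key : ∀ (p : MvPolynomial (Fin 2) k) (s : Fin 2 →₀ ℕ),
      coeff ((0, 0, s 0, s 1) : ℤ × ℤ × ℕ × ℕ)
        (toTorus hq0 h4 (MvPolynomial.aeval (R := k) ![x, y] p : UPlus q)) = p.coeff s := by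
    intro p s
    induction p using MvPolynomial.induction_on' with
    | monomial t a =>
      have h : (MvPolynomial.aeval (R := k) ![x, y] (MvPolynomial.monomial t a) : UPlus q) =
          a • (z q ^ t 0 * z' q ^ t 1) := by
        rw [MvPolynomial.aeval_monomial, Finsupp.prod_fintype _ _ (fun i => pow_zero _),
          Fin.prod_univ_two, ← Algebra.smul_def, ← hx, ← hy]
        rfl
      rw [h, map_smul, toTorus_z_pow_mul_z'_pow, smul_tmono, MvPolynomial.coeff_monomial]
      split_ifs with hts
      · rw [hts, coeff_mono_self]
      · refine coeff_mono_of_ne (fun e => hts ?_) a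
        simp only [Prod.mk.injEq, true_and] at e
        ext i
        fin_cases i
        · exact e.1.symm
        · exact e.2.symm
    | add p p' hp hp' =>
      rw [MvPolynomial.coeff_add, ← hp, ← hp', map_add, Subalgebra.coe_add, map_add, map_add]
  intro p p' h
  ext s
  rw [← key, ← key, h]

end UqB2

theorem lemma3p1 {k : Type*} [Field k] [IsAlgClosed k] [CharZero k] (q : k) (hq0 : q ≠ 0)
    (hq : ∀ n : ℕ, 0 < n → q ^ n ≠ 1) :
    {f : UqB2.UPlus q | UqB2.IsNormalElement f}
        = (Subalgebra.center k (UqB2.UPlus q) : Set (UqB2.UPlus q)) ∧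
      Subalgebra.center k (UqB2.UPlus q) = Algebra.adjoin k {UqB2.z q, UqB2.z' q} ∧
      (∃ φ : MvPolynomial (Fin 2) k ≃ₐ[k] Subalgebra.center k (UqB2.UPlus q),
        (φ (MvPolynomial.X 0) : UqB2.UPlus q) = UqB2.z q ∧
        (φ (MvPolynomial.X 1) : UqB2.UPlus q) = UqB2.z' q) ∧
      UqB2.z q ∈ UqB2.component q 3 ∧ UqB2.z' q ∈ UqB2.component q 4 := by
  have h4 := hq 4 (by norm_num)
  have hle := UqB2.adjoin_le_center hq0
  have hcenter : Subalgebra.center k (UqB2.UPlus q) = Algebra.adjoin k {UqB2.z q, UqB2.z' q} :=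
    -- Adjoin ⊆ center ⊆ normal ⊆ adjoin, so all three sets coincide.
    le_antisymm (fun f hf => UqB2.mem_adjoin_of_normal hq0 hq
      (UqB2.isNormalElement_of_mem_center hf)) hle
  refine ⟨?_, hcenter, ?_, UqB2.z_mem_component, UqB2.z'_mem_component⟩
  · ext f
    exact ⟨fun hf => hle (UqB2.mem_adjoin_of_normal hq0 hq hf),
      UqB2.isNormalElement_of_mem_center⟩
  · let x : Subalgebra.center k (UqB2.UPlus q) :=
      ⟨UqB2.z q, hle (Algebra.subset_adjoin (Or.inl rfl))⟩
    let y : Subalgebra.center k (UqB2.UPlus q) :=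
      ⟨UqB2.z' q, hle (Algebra.subset_adjoin (Or.inr rfl))⟩
    have hsurj : Function.Surjective (MvPolynomial.aeval (R := k) ![x, y]) := by
      rintro ⟨f, hf⟩
      have hf' := hf
      rw [hcenter] at hf'
      have hr : Algebra.adjoin k {UqB2.z q, UqB2.z' q} ≤
          ((Subalgebra.center k (UqB2.UPlus q)).val.comp
            (MvPolynomial.aeval (R := k) ![x, y])).range := by
        rw [Algebra.adjoin_le_iff]
        rintro _ (rfl | rfl)
        · exact ⟨MvPolynomial.X 0, congrArg Subtype.val (MvPolynomial.aeval_X _ _)⟩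
        · exact ⟨MvPolynomial.X 1, congrArg Subtype.val (MvPolynomial.aeval_X _ _)⟩
      obtain ⟨p, hp⟩ := hr hf'
      exact ⟨p, Subtype.ext hp⟩
    refine ⟨AlgEquiv.ofBijective _ ⟨UqB2.aeval_injective hq0 h4 (x := x) (y := y) rfl rfl, hsurj⟩,
      ?_, ?_⟩
    · exact congrArg Subtype.val (MvPolynomial.aeval_X _ _)
    · exact congrArg Subtype.val (MvPolynomial.aeval_X _ _)
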